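/- Let $\Omega=(0,1)$ and let $\Lambda$ be a nonempty compact metric space. Consider the boundary value problem $$-\max_{\gamma\in[0,\infty),\,\lambda\in\Lambda}\Big\{\tfrac12\sigma(x,\lambda)^2U''+\mu(x,\lambda)U'-\eta U-\tfrac12\alpha\gamma^2U+\beta\gamma\Big\}=0\ \text{ on }\Omega,\qquad U=g\ \text{ on }\partial\Omega. \tag{1}$$ Let $F(x,r,p,X)$ denote the full operator: for $x\in\Omega$ it is minus the supremum (in $[-\infty,\infty]$) of the bracket with $U,U',U''$ replaced by $r,p,X$, and $F=r-g(x)$ for $x\in\partial\Omega$. Let $F_*$ and $F^*$ be its lower and upper semicontinuous envelopes on $\overline\Omega\times\mathbb R^3$. A bounded upper semicontinuous $u:\overline\Omega\to\mathbb R$ is a *subsolution* if $F_*(x,u(x),\varphi'(x),\varphi''(x))\le0$ whenever $\varphi\in C^2$ and $u-\varphi$ has a local maximum relative to $\overline\Omega$ at $x\in\overline\Omega$. A bounded lower semicontinuous $v$ is a *supersolution* if $F^*(x,v(x),\varphi'(x),\varphi''(x))\ge0$ whenever $\varphi\in C^2$ and $v-\varphi$ has a local minimum relative to $\overline\Omega$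 at $x\in\overline\Omega$. A bounded function is a *viscosity solution* of (1) if its upper semicontinuous envelope is a subsolution and its lower semicontinuous envelope is a supersolution. The *strong comparison principle* says that $u\le v$ on $\overline\Omega$ for every subsolution $u$ and every supersolution $v$. Assume: - (A1) to each $\Delta x>0$ is associated a nonempty finite set $\Lambda_{\Delta x}\subset\Lambda$, with $d_H(\Lambda_{\Delta x},\Lambda)\to0$ (Hausdorff distance) as $\Delta x\downarrow0$; - (A2) $\sigma,\mu:\overline\Omega\times\Lambda\to\mathbb R$ are bounded and the families $\{\sigma(x,\cdot)\}_{x\in\overline\Omega}$ and $\{\mu(x,\cdot)\}_{x\in\overline\Omega}$ are equicontinuous on $\Lambda$ (for instance, $\sigma$ and $\mu$ are continuous on $\overline\Omega\times\Lambda$); $\eta,\alpha,\beta,g:\overline\Omega\to(0,\infty)$, and $g$ is bounded; - (A3) $\sup_x\beta(x)^2/(\alpha(x)\eta(x))<\infty$; - the strong comparison principle holds for (1). For an integer $M\ge1$ put $\Delta x=1/M$ and $x_i=i\Delta x$, and write $\eta_i=\eta(x_i)$, $\sigma_i(\lambda)=\sigma(x_i,\lambda)$, etc. For $\boldsymbol\lambda=(\lambda_0,\dots,\lambda_M)\in(\Lambda_{\Delta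 x})^{M+1}$, let $A(\boldsymbol\lambda)=(a_{ijk})_{0\le i,j,k\le M}$ be the order-3 tensor whose only nonzero entries are, for $0<i<M$, $$a_{iii}=\frac{\sigma_i(\lambda_i)^2}{(\Delta x)^2}+\frac{|\mu_i(\lambda_i)|}{\Delta x}+\eta_i,\qquad 2a_{i,i,i-1}=2a_{i,i-1,i}=-\frac{\sigma_i(\lambda_i)^2}{2(\Delta x)^2}+\frac{\min(\mu_i(\lambda_i),0)}{\Delta x},$$ $$2a_{i,i,i+1}=2a_{i,i+1,i}=-\frac{\sigma_i(\lambda_i)^2}{2(\Delta x)^2}-\frac{\max(\mu_i(\lambda_i),0)}{\Delta x},$$ and $a_{iii}=1$ for $i\in\{0,M\}$. Let $b_i=\beta_i^2/(2\alpha_i)$ for $0<i<M$ and $b_i=g_i^2$ for $i\in\{0,M\}$. With $(Au^2)_i=\sum_{j,k}a_{ijk}u_ju_k$ and the minimum taken coordinatewise, consider the order-3 Bellman equation $$\min_{\boldsymbol\lambda\in(\Lambda_{\Delta x})^{M+1}}A(\boldsymbol\lambda)u^2=b.\tag{2}$$ **Theorem.** For every $M\ge1$, equation (2) has a unique positive solution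 $u=(u_0,\dots,u_M)$. The function $u_{\Delta x}:\overline\Omega\to\mathbb R$ given by $u_{\Delta x}(x)=\sum_{i=0}^Mu_i\mathbf 1_{[x_i-\Delta x/2,\,x_i+\Delta x/2)}(x)$ satisfies $$u_{\Delta x}\le\sup_{x\in\overline\Omega}\max\left(\sqrt{\tfrac12\frac{\beta(x)^2}{\alpha(x)\eta(x)}},\,g(x)\right)<\infty .$$ Moreover, (1) has exactly one viscosity solution $U$, it is continuous, and $u_{\Delta x}\to U$ uniformly on $\overline\Omega$ as $\Delta x=1/M\downarrow0$. -/

import Mathlib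

open Filter Topology
open scoped NNReal

noncomputable section

namespace HJBScheme

/-- The coefficients of the differential equation on `[0,1]` with control set `Λ`. -/
structure Coeffs (Λ : Type*) where
  σ : unitInterval → Λ → ℝ
  μ : unitInterval → Λ → ℝ
  η : unitInterval → ℝ
  α : unitInterval → ℝ
  β : unitInterval → ℝ
  g : unitInterval → ℝ

/-! ### The differential equation and its viscosity solutions -/

/-- The full operator of the boundary value problem, evaluated at a point `x`, a value `r`, a first
derivative `p` and a second derivative `X`. In the open interval it is
`-sup_{γ ≥ 0, l ∈ Λ} (σ² X / 2 + μ p - η r - α γ² r / 2 + β γ)`, a supremum in the extended reals;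
at the two boundary points it is `r - g`. -/
def hjbOp {Λ : Type*} (c : Coeffs Λ) (z : unitInterval × ℝ × ℝ × ℝ) : EReal :=
  match z with
  | (x, r, p, X) =>
    if x = 0 ∨ x = 1 then ((r - c.g x : ℝ) : EReal)
    else -(⨆ γ : ℝ≥0, ⨆ l : Λ,
      ((1 / 2 * c.σ x l ^ 2 * X + c.μ x l * p - c.η x * r
        - 1 / 2 * c.α x * (γ : ℝ) ^ 2 * r + c.β x * (γ : ℝ) : ℝ) : EReal))

/-- The lower semicontinuous envelope of the full operator, in all its variables. -/
def hjbLower {Λ : Type*} (c : Coeffs Λ) (z : unitInterval × ℝ × ℝ × ℝ) : EReal :=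
  liminf (hjbOp c) (𝓝 z)

/-- The upper semicontinuous envelope of the full operator, in all its variables. -/
def hjbUpper {Λ : Type*} (c : Coeffs Λ) (z : unitInterval × ℝ × ℝ × ℝ) : EReal :=
  limsup (hjbOp c) (𝓝 z)

/-- Boundedness of a real function on `[0,1]`. -/
def IsBdd (u : unitInterval → ℝ) : Prop := ∃ C : ℝ, ∀ x, |u x| ≤ C

/-- Bounded upper semicontinuous viscosity subsolutions on the closed interval. Local maxima are
relative to `[0,1]`, so the boundary condition is understood in the viscosity sense. -/
def IsSubsolution {Λ : Type*} (c : Coeffs Λ) (u : unitInterval → ℝ) : Prop :=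
  IsBdd u ∧ UpperSemicontinuous u ∧
    ∀ φ : ℝ → ℝ, ContDiff ℝ 2 φ → ∀ x : unitInterval,
      IsLocalMax (fun y : unitInterval => u y - φ y) x →
        hjbLower c (x, u x, deriv φ x, deriv (deriv φ) x) ≤ 0

/-- Bounded lower semicontinuous viscosity supersolutions on the closed interval. -/
def IsSupersolution {Λ : Type*} (c : Coeffs Λ) (v : unitInterval → ℝ) : Prop :=
  IsBdd v ∧ LowerSemicontinuous v ∧
    ∀ φ : ℝ → ℝ, ContDiff ℝ 2 φ → ∀ x : unitInterval,
      IsLocalMin (fun y : unitInterval => v y - φ y) x →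
        0 ≤ hjbUpper c (x, v x, deriv φ x, deriv (deriv φ) x)

/-- A (possibly discontinuous) bounded viscosity solution: its upper semicontinuous envelope is a
subsolution and its lower semicontinuous envelope is a supersolution. -/
def IsViscositySolution {Λ : Type*} (c : Coeffs Λ) (U : unitInterval → ℝ) : Prop :=
  IsBdd U ∧ IsSubsolution c (fun x => limsup U (𝓝 x)) ∧
    IsSupersolution c (fun x => liminf U (𝓝 x))

/-- The strong comparison principle: subsolutions lie below supersolutions on all of `[0,1]`. -/
def StrongComparison {Λ : Type*} (c : Coeffs Λ) : Prop :=
  ∀ u v : unitInterval → ℝ, IsSubsolution c u → IsSupersolution c v → ∀ x, u x ≤ v x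

/-! ### The Bellman equation of order three -/

/-- The vector `A u²` for a real tensor `A` of order three. -/
def tensorSq {n : ℕ} (A : Fin n → Fin n → Fin n → ℝ) (u : Fin n → ℝ) (i : Fin n) : ℝ :=
  ∑ j, ∑ k, A i j k * u j * u k

/-- The grid point `i Δx`, where `Δx = 1 / M`. -/
def gridPoint (M : ℕ) (i : Fin (M + 1)) : unitInterval :=
  ⟨(i : ℝ) / M, unitInterval.div_mem (by positivity) (by positivity)
    (by exact_mod_cast Nat.lt_succ_iff.mp i.isLt)⟩

/-- The tensor `A(l)` of the scheme with `Δx = 1 / M`, for a policy `l = (l_0, …, l_M)`. -/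
def schemeTensor {Λ : Type*} (c : Coeffs Λ) (M : ℕ) (l : Fin (M + 1) → Λ)
    (i j k : Fin (M + 1)) : ℝ :=
  let Δ : ℝ := 1 / M
  let s : ℝ := c.σ (gridPoint M i) (l i)
  let m : ℝ := c.μ (gridPoint M i) (l i)
  if 0 < (i : ℕ) ∧ (i : ℕ) < M then
    if j = i ∧ k = i then
      1 / 2 * s ^ 2 * (2 / Δ ^ 2) + |m| * (1 / Δ) + c.η (gridPoint M i)
    else if (j = i ∧ (k : ℕ) + 1 = i) ∨ ((j : ℕ) + 1 = i ∧ k = i) then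
      (-(1 / 2 * s ^ 2 * (1 / Δ ^ 2)) + (if m < 0 then m * (1 / Δ) else 0)) / 2
    else if (j = i ∧ (k : ℕ) = i + 1) ∨ ((j : ℕ) = i + 1 ∧ k = i) then
      (-(1 / 2 * s ^ 2 * (1 / Δ ^ 2)) - (if 0 < m then m * (1 / Δ) else 0)) / 2
    else 0
  else if j = i ∧ k = i then 1 else 0

/-- The right-hand side `b` of the scheme. -/
def schemeVec {Λ : Type*} (c : Coeffs Λ) (M : ℕ) (i : Fin (M + 1)) : ℝ :=
  if 0 < (i : ℕ) ∧ (i : ℕ) < M then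
    1 / 2 * (c.β (gridPoint M i) ^ 2 / c.α (gridPoint M i))
  else c.g (gridPoint M i) ^ 2

/-- `u` is a positive solution of `min_{l ∈ S^(M+1)} A(l) u² = b`, the minimum being taken
coordinatewise. -/
def IsPositiveSolution {Λ : Type*} (c : Coeffs Λ) (S : Finset Λ) (M : ℕ)
    (u : Fin (M + 1) → ℝ) : Prop :=
  (∀ i, 0 < u i) ∧
    ∀ i, IsLeast ((fun l : Fin (M + 1) → Λ => tensorSq (schemeTensor c M l) u i) ''
      {l | ∀ j, l j ∈ S}) (schemeVec c M i)

/-- The piecewise constant interpolant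
`x ↦ ∑ i, u_i 1_{[x_i - Δx/2, x_i + Δx/2)}(x)` on `[0,1]`, with `Δx = 1 / M`. -/
def interpolant (M : ℕ) (u : Fin (M + 1) → ℝ) (x : unitInterval) : ℝ :=
  ∑ i, (Set.Ico ((gridPoint M i : ℝ) - 1 / M / 2) ((gridPoint M i : ℝ) + 1 / M / 2)).indicator
    (fun _ => u i) (x : ℝ)

end HJBScheme

end

/-! The quadratic system is a monotone upwind scheme in disguise. For `u i > 0`, dividing an
interior row `u i * (∑ j, w i l j * (u i - u j) + e i * u i)` and its right-hand side by `u i`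
leaves `β² / (2 α u i)` on the right, which is the maximum over `γ ≥ 0` of `β γ - α γ² u i / 2`,
attained at `γ = β / (α u i)`. The order-three equation has thus eliminated the unbounded control
exactly.

Since the weights on the differences `u i - u j` are nonnegative, maximum principle arguments apply:
uniqueness by looking where `u - v` is largest (`le_of_quadOp_isLeast`), existence by taking a
subsolution of largest sum (`existsUnique_quadOp_isLeast`), the bound by looking where `u` is
largest (`exists_max_of_quadOp_isLeast`).

Convergence is the Barles–Souganidis argument. Take the upper and lower limits jointly in the mesh
size and the grid point. An extremum of a relaxed limit minus a test function is approximated by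
discrete extrema (`frequently_isMax_of_isLocalMax`); there monotonicity replaces the discrete
solution by the test function, and consistency of the difference quotients bounds the operator. The
estimate concerns the operator at grid points, so its semicontinuous envelopes absorb both the
boundary condition and discontinuities in `x`. Strong comparison makes the two relaxed limits equal;
their common value is the continuous solution, and compactness gives uniform convergence. -/

noncomputable section

namespace HJBScheme

/-! ### Monotone Bellman systems -/

section Monotone

variable {ι Λ : Type*} [Fintype ι]

/-- The `i`-th component, under the control `l`, of a quadratic monotone system with weights `w`
and zeroth order coefficients `e`. -/
def quadOp (w : ι → Λ → ι → ℝ) (e : ι → ℝ) (i : ι) (l : Λ) (u : ι → ℝ) : ℝ :=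
  u i * (∑ j, w i l j * (u i - u j) + e i * u i)

variable {w : ι → Λ → ι → ℝ} {e b : ι → ℝ} {S : Finset Λ}

theorem continuous_quadOp (i : ι) (l : Λ) : Continuous (quadOp w e i l) := by
  unfold quadOp
  fun_prop

theorem sum_weight_nonneg (hw : ∀ i l j, 0 ≤ w i l j) {i : ι} {u : ι → ℝ} (hu : ∀ j, u j ≤ u i)
    (l : Λ) : 0 ≤ ∑ j, w i l j * (u i - u j) :=
  Finset.sum_nonneg fun j _ => mul_nonneg (hw i l j) (sub_nonneg.2 (hu j))

/-- Comparison for positive solutions of a monotone Bellman system. -/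
theorem le_of_quadOp_isLeast (hw : ∀ i l j, 0 ≤ w i l j) (he : ∀ i, 0 < e i) (hb : ∀ i, 0 < b i)
    {u v : ι → ℝ} (hv : ∀ i, 0 < v i)
    (hub : ∀ i, IsLeast ((fun l => quadOp w e i l u) '' S) (b i))
    (hvb : ∀ i, IsLeast ((fun l => quadOp w e i l v) '' S) (b i)) : u ≤ v := by
  intro k
  by_contra! hk
  have : Nonempty ι := ⟨k⟩
  obtain ⟨i, hi⟩ := Finite.exists_max fun i => u i - v i
  have hpos : v i < u i := by have := hi k; linarith
  -- A control optimal for `u` is merely admissible for `v`; this one control suffices for the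
  -- contradiction.
  obtain ⟨l', hl', hlu'⟩ := (hub i).1
  have hlv' : b i ≤ quadOp w e i l' v := (hvb i).2 ⟨l', hl', rfl⟩
  simp only [quadOp] at hlv' hlu'
  have hsum' : ∑ j, w i l' j * (v i - v j) ≤ ∑ j, w i l' j * (u i - u j) :=
    Finset.sum_le_sum fun j _ => mul_le_mul_of_nonneg_left (by have := hi j; linarith) (hw i l' j)
  -- Positivity of `b` makes the bracket of `v` positive, so that the product of the two factors is
  -- strictly monotone.
  have hnn' : 0 < ∑ j, w i l' j * (v i - v j) + e i * v i :=
    pos_of_mul_pos_right ((hb i).trans_le hlv') (hv i).le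
  have h1 : v i * (∑ j, w i l' j * (v i - v j) + e i * v i)
      < u i * (∑ j, w i l' j * (u i - u j) + e i * u i) :=
    mul_lt_mul'' hpos (add_lt_add_of_le_of_lt hsum' (mul_lt_mul_of_pos_left hpos (he i)))
      (hv i).le hnn'.le
  linarith

/-- At its maximum, a positive solution is controlled by the zeroth order data. -/
theorem exists_max_of_quadOp_isLeast [Nonempty ι] (hw : ∀ i l j, 0 ≤ w i l j) {u : ι → ℝ}
    (hu : ∀ i, 0 < u i) (hub : ∀ i, IsLeast ((fun l => quadOp w e i l u) '' S) (b i)) :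
    ∃ i, (∀ j, u j ≤ u i) ∧ e i * u i ^ 2 ≤ b i := by
  obtain ⟨i, hi⟩ := Finite.exists_max u
  refine ⟨i, hi, ?_⟩
  obtain ⟨l, -, hl⟩ := (hub i).1
  simp only [quadOp] at hl
  have := mul_nonneg (hu i).le (sum_weight_nonneg hw hi l)
  nlinarith

/-- A monotone Bellman system has exactly one positive solution. -/
theorem existsUnique_quadOp_isLeast [Nonempty ι] (hS : S.Nonempty) (hw : ∀ i l j, 0 ≤ w i l j)
    (he : ∀ i, 0 < e i) (hb : ∀ i, 0 < b i) :
    ∃! u : ι → ℝ, (∀ i, 0 < u i) ∧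
      ∀ i, IsLeast ((fun l => quadOp w e i l u) '' S) (b i) := by
  classical
  obtain ⟨i₀, hi₀⟩ := Finite.exists_min fun i => Real.sqrt (b i / e i)
  obtain ⟨i₁, hi₁⟩ := Finite.exists_max fun i => Real.sqrt (b i / e i)
  set m := Real.sqrt (b i₀ / e i₀)
  set K := Real.sqrt (b i₁ / e i₁)
  have hm : 0 < m := Real.sqrt_pos.2 (div_pos (hb _) (he _))
  have hmK : m ≤ K := hi₀ i₁
  have hmb : ∀ i, e i * m ^ 2 ≤ b i := fun i => by
    have h := pow_le_pow_left₀ hm.le (hi₀ i) 2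
    rw [Real.sq_sqrt (div_pos (hb i) (he i)).le, le_div_iff₀ (he i)] at h
    linarith
  have hKb : ∀ i, b i ≤ e i * K ^ 2 := fun i => by
    have h := pow_le_pow_left₀ (Real.sqrt_nonneg _) (hi₁ i) 2
    rw [Real.sq_sqrt (div_pos (hb i) (he i)).le, div_le_iff₀ (he i)] at h
    linarith
  -- Subsolutions in a box: the union over `l` says that the minimum over controls is at most `b i`.
  -- The lower bound `m > 0` keeps the maximizer positive, and the constant `m` is itself a
  -- subsolution.
  set P : Set (ι → ℝ) := Set.Icc (fun _ => m) (fun _ => K) ∩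
    ⋂ i, ⋃ l ∈ S, {u | quadOp w e i l u ≤ b i} with hP
  have hPc : IsCompact P := by
    refine isCompact_Icc.inter_right (isClosed_iInter fun i => ?_)
    exact S.finite_toSet.isClosed_biUnion
      fun l _ => isClosed_le (continuous_quadOp i l) continuous_const
  obtain ⟨l₀, hl₀⟩ := hS
  have hPn : P.Nonempty := by
    refine ⟨fun _ => m, ⟨le_rfl, fun _ => hmK⟩, Set.mem_iInter.2 fun i =>
      Set.mem_biUnion hl₀ ?_⟩
    simp only [quadOp, Set.mem_ofPred_eq, sub_self, mul_zero, Finset.sum_const_zero, zero_add]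
    linarith [hmb i]
  -- A maximizer of the sum cannot be raised in any coordinate inside `P`, which will force equality
  -- in every row.
  obtain ⟨u, huP, hmax⟩ := hPc.exists_isMaxOn hPn
    (f := fun u : ι → ℝ => ∑ i, u i) (by fun_prop)
  have hum : ∀ i, m ≤ u i := huP.1.1
  have huK : ∀ i, u i ≤ K := huP.1.2
  have hu : ∀ i, 0 < u i := fun i => hm.trans_le (hum i)
  have hsub : ∀ i, ∃ l ∈ S, quadOp w e i l u ≤ b i := fun i => by
    simpa using Set.mem_iInter.1 huP.2 i
  have hsup : ∀ i, ∀ l ∈ S, b i ≤ quadOp w e i l u := by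
    intro i l hl
    by_contra! hlt
    -- At height `K` the coordinate would be a maximum of `u`, and its row would be at least `e i *
    -- K ^ 2 ≥ b i`. So there is room to raise it.
    have huKi : u i < K := by
      refine lt_of_le_of_ne (huK i) fun h => ?_
      have h1 := mul_nonneg (hu i).le
        (sum_weight_nonneg hw (i := i) (u := u) (fun j => h ▸ huK j) l)
      have h2 := hKb i
      rw [← h] at h2
      simp only [quadOp] at hlt
      nlinarith
    have hcont : Continuous fun t : ℝ => quadOp w e i l (Function.update u i (u i + t)) :=
      (continuous_quadOp i l).comp (continuous_const.update i (by fun_prop))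
    have hev : ∀ᶠ t : ℝ in 𝓝 0, quadOp w e i l (Function.update u i (u i + t)) < b i :=
      hcont.continuousAt.eventually_lt continuousAt_const (by simpa using hlt)
    have hev' : ∀ᶠ t : ℝ in 𝓝[>] 0, t < K - u i :=
      (eventually_lt_nhds (by linarith)).filter_mono nhdsWithin_le_nhds
    obtain ⟨t, ⟨ht1, ht2⟩, ht0⟩ :=
      (((hev.filter_mono nhdsWithin_le_nhds).and hev').and self_mem_nhdsWithin).exists
    have ht0 : 0 < t := ht0
    set v := Function.update u i (u i + t) with hv
    have hvi : v i = u i + t := by simp [hv]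
    have hvj : ∀ j, j ≠ i → v j = u j := fun j hj => by simp [hv, hj]
    have huv : ∀ j, u j ≤ v j := fun j => by
      by_cases hj : j = i
      · subst hj; linarith
      · exact (hvj j hj).ge
    have hvP : v ∈ P := by
      refine ⟨⟨fun j => (hum j).trans (huv j), fun j => ?_⟩, Set.mem_iInter.2 fun j => ?_⟩
      · by_cases hj : j = i
        · subst hj; show v j ≤ K; linarith
        · show v j ≤ K; rw [hvj j hj]; exact huK j
      · by_cases hj : j = i
        · subst hj; exact Set.mem_biUnion hl ht1.le
        -- Raising coordinate `i` only lowers the other rows, since their off-diagonal couplings are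
        -- nonpositive.
        · obtain ⟨l', hl', hle⟩ := hsub j
          refine Set.mem_biUnion hl' (le_trans ?_ hle)
          simp only [quadOp, hvj j hj]
          refine mul_le_mul_of_nonneg_left (add_le_add_left ?_ _) (hu j).le
          exact Finset.sum_le_sum fun k _ =>
            mul_le_mul_of_nonneg_left (by linarith [huv k]) (hw j l' k)
    have h1 : ∑ j, v j ≤ ∑ j, u j := hmax hvP
    have h2 : ∑ j, u j < ∑ j, v j :=
      Finset.sum_lt_sum (fun j _ => huv j) ⟨i, Finset.mem_univ i, by linarith⟩
    linarith
  have hsol : ∀ i, IsLeast ((fun l => quadOp w e i l u) '' S) (b i) := fun i => by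
    obtain ⟨l, hl, hle⟩ := hsub i
    refine ⟨⟨l, hl, le_antisymm hle (hsup i l hl)⟩, ?_⟩
    rintro _ ⟨l', hl', rfl⟩
    exact hsup i l' hl'
  refine ⟨u, ⟨hu, hsol⟩, fun v hv => le_antisymm ?_ ?_⟩
  · exact le_of_quadOp_isLeast hw he hb hu hv.2 hsol
  · exact le_of_quadOp_isLeast hw he hb hv.1 hsol hv.2

end Monotone

/-! ### The scheme as a monotone Bellman system -/

variable {Λ : Type*}

/-- The weights of the upwind discretization. -/
def schemeWeight (c : Coeffs Λ) (M : ℕ) (i : Fin (M + 1)) (l : Λ) (j : Fin (M + 1)) : ℝ :=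
  if 0 < (i : ℕ) ∧ (i : ℕ) < M then
    if (j : ℕ) + 1 = i then
      1 / 2 * c.σ (gridPoint M i) l ^ 2 * M ^ 2 + max (-c.μ (gridPoint M i) l) 0 * M
    else if (j : ℕ) = i + 1 then
      1 / 2 * c.σ (gridPoint M i) l ^ 2 * M ^ 2 + max (c.μ (gridPoint M i) l) 0 * M
    else 0
  else 0

/-- The zeroth order coefficients of the discretization. -/
def schemeDiag (c : Coeffs Λ) (M : ℕ) (i : Fin (M + 1)) : ℝ :=
  if 0 < (i : ℕ) ∧ (i : ℕ) < M then c.η (gridPoint M i) else 1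

theorem schemeWeight_nonneg (c : Coeffs Λ) (M : ℕ) (i : Fin (M + 1)) (l : Λ) (j : Fin (M + 1)) :
    0 ≤ schemeWeight c M i l j := by
  unfold schemeWeight
  split_ifs <;> positivity

theorem sum_schemeWeight_mul (c : Coeffs Λ) (M : ℕ) (i p n : Fin (M + 1)) (hp : (p : ℕ) + 1 = i)
    (hn : (n : ℕ) = i + 1) (l : Λ) (f : Fin (M + 1) → ℝ) :
    ∑ j, schemeWeight c M i l j * f j =
      (1 / 2 * c.σ (gridPoint M i) l ^ 2 * M ^ 2 + max (-c.μ (gridPoint M i) l) 0 * M) * f p +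
      (1 / 2 * c.σ (gridPoint M i) l ^ 2 * M ^ 2 + max (c.μ (gridPoint M i) l) 0 * M) * f n := by
  have hi : 0 < (i : ℕ) ∧ (i : ℕ) < M := ⟨by omega, by have := n.isLt; omega⟩
  have hpn : p ≠ n := fun h => by subst h; omega
  rw [Finset.sum_eq_add p n hpn]
  · simp [schemeWeight, hi, hp, hn, show (i : ℕ) + 1 + 1 ≠ i by omega]
  · rintro j - ⟨hjp, hjn⟩
    have h1 : (j : ℕ) + 1 ≠ i := fun h => hjp (Fin.ext (by omega))
    have h2 : (j : ℕ) ≠ i + 1 := fun h => hjn (Fin.ext (by omega))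
    simp [schemeWeight, h1, h2]
  · simp
  · simp

/-- Each off-diagonal weight is split equally between the two symmetric positions. Writing the
entries as a sum of separate conditionals lets the double sum in `tensorSq` collapse term by term.
-/
theorem schemeTensor_eq (c : Coeffs Λ) {M : ℕ} (hM : 0 < M) (l : Fin (M + 1) → Λ)
    (i j k : Fin (M + 1)) :
    schemeTensor c M l i j k =
      (if j = i then (if k = i then
        (∑ j, schemeWeight c M i (l i) j * 1) + schemeDiag c M i else 0) else 0)
      - (if j = i then schemeWeight c M i (l i) k / 2 else 0)
      - (if k = i then schemeWeight c M i (l i) j / 2 else 0) := by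
  have hM' : (M : ℝ) ≠ 0 := by positivity
  by_cases hi : 0 < (i : ℕ) ∧ (i : ℕ) < M
  · rw [sum_schemeWeight_mul c M i ⟨i - 1, by omega⟩ ⟨i + 1, by omega⟩ (by simp; omega) rfl (l i)]
    have hneg : ∀ m : ℝ, (if m < 0 then m else 0) = -max (-m) 0 := fun m => by
      rcases lt_or_ge m 0 with h | h
      · simp [h, h.le]
      · simp [h]
    have hposm : ∀ m : ℝ, (if 0 < m then m else 0) = max m 0 := fun m => by
      rcases lt_or_ge 0 m with h | h
      · simp [h, h.le]
      · simp [h, not_lt.2 h]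
    have habs : ∀ m : ℝ, |m| = max (-m) 0 + max m 0 := fun m => by
      rcases le_total 0 m with h | h
      · simp [h, abs_of_nonneg h]
      · simp [h, abs_of_nonpos h]
    have hneg' : ∀ m D : ℝ, (if m < 0 then m * D else 0) = -max (-m) 0 * D := fun m D => by
      rw [← hneg, ite_mul, zero_mul]
    have hpos' : ∀ m D : ℝ, (if 0 < m then m * D else 0) = max m 0 * D := fun m D => by
      rw [← hposm, ite_mul, zero_mul]
    simp only [schemeTensor, schemeWeight, schemeDiag, hi, and_self, if_true, hneg', hpos', habs]
    by_cases hji : j = i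
    · subst hji
      by_cases hki : k = j
      · subst hki
        simp
        ring
      · have hkv : (k : ℕ) ≠ j := fun h => hki (Fin.ext h)
        by_cases h1 : (k : ℕ) + 1 = j
        · simp [hki, h1]; ring
        · by_cases h2 : (k : ℕ) = j + 1
          · simp [hki, h2, show (j : ℕ) + 1 + 1 ≠ j by omega]; ring
          · simp [hki, h1, h2]
    · by_cases hki : k = i
      · subst hki
        by_cases h1 : (j : ℕ) + 1 = k
        · simp [hji, h1]; ring
        · by_cases h2 : (j : ℕ) = k + 1
          · simp [hji, h2, show (k : ℕ) + 1 + 1 ≠ k by omega]; ring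
          · simp [hji, h1, h2]
      · simp [hji, hki]
  · simp only [schemeTensor, schemeWeight, schemeDiag, hi, if_false]
    by_cases hji : j = i <;> by_cases hki : k = i <;> simp [hji, hki]

theorem tensorSq_schemeTensor (c : Coeffs Λ) {M : ℕ} (hM : 0 < M) (l : Fin (M + 1) → Λ)
    (u : Fin (M + 1) → ℝ) (i : Fin (M + 1)) :
    tensorSq (schemeTensor c M l) u i = quadOp (schemeWeight c M) (schemeDiag c M) i (l i) u := by
  have h1 : ∀ j k, schemeTensor c M l i j k * u j * u k =
      (if j = i then (if k = i then
        ((∑ j, schemeWeight c M i (l i) j * 1) + schemeDiag c M i) * u i * u i else 0) else 0)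
      - (if j = i then schemeWeight c M i (l i) k / 2 * u i * u k else 0)
      - (if k = i then schemeWeight c M i (l i) j / 2 * u j * u i else 0) := fun j k => by
    rw [schemeTensor_eq c hM]
    by_cases hji : j = i <;> by_cases hki : k = i <;> simp [hji, hki]
    ring
  simp only [tensorSq, h1, Finset.sum_sub_distrib, Finset.sum_ite_eq', Finset.sum_ite_irrel,
    Finset.mem_univ, if_true, Finset.sum_const_zero, quadOp, mul_sub, mul_one, add_mul, mul_add,
    Finset.sum_mul, Finset.mul_sum]
  have h2 : ∑ x, u i * (schemeWeight c M i (l i) x * u x) =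
      ∑ x, schemeWeight c M i (l i) x / 2 * u i * u x +
        ∑ x, schemeWeight c M i (l i) x / 2 * u x * u i := by
    rw [← Finset.sum_add_distrib]
    exact Finset.sum_congr rfl fun _ _ => by ring
  have h3 : ∑ x, schemeWeight c M i (l i) x * u i * u i =
      ∑ x, u i * (schemeWeight c M i (l i) x * u i) :=
    Finset.sum_congr rfl fun _ _ => by ring
  rw [h2, h3]
  ring

/-- Row `i` sees the policy only through `l i`, so the minimum over policies decouples into minima
over single controls; constant policies realize them all. -/
theorem isPositiveSolution_iff (c : Coeffs Λ) (S : Finset Λ) {M : ℕ} (hM : 0 < M)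
    (u : Fin (M + 1) → ℝ) : IsPositiveSolution c S M u ↔ (∀ i, 0 < u i) ∧
      ∀ i, IsLeast ((fun l => quadOp (schemeWeight c M) (schemeDiag c M) i l u) '' S)
        (schemeVec c M i) := by
  refine and_congr_right fun _ => forall_congr' fun i => ?_
  have : (fun l : Fin (M + 1) → Λ => tensorSq (schemeTensor c M l) u i) '' {l | ∀ j, l j ∈ S} =
      (fun l => quadOp (schemeWeight c M) (schemeDiag c M) i l u) '' S := by
    ext t
    simp only [tensorSq_schemeTensor c hM, Set.mem_image, Set.mem_ofPred_eq]
    exact ⟨fun ⟨l, hl, h⟩ => ⟨l i, hl i, h⟩, fun ⟨l, hl, h⟩ => ⟨fun _ => l, fun _ => hl, h⟩⟩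
  rw [this]

/-! ### Grid points and the interpolant -/

/-- The index of the cell `[x_i - Δx/2, x_i + Δx/2)` that contains `y`. -/
def cellIndex (M : ℕ) (y : unitInterval) : Fin (M + 1) :=
  ⟨⌊(M : ℝ) * y + 1 / 2⌋₊, by
    have h1 : (M : ℝ) * y ≤ M := mul_le_of_le_one_right (by positivity) y.2.2
    have h0 : 0 ≤ (M : ℝ) * y := mul_nonneg (by positivity) y.2.1
    rw [Nat.floor_lt (by positivity)]
    push_cast
    linarith⟩

theorem mem_cell_iff {M : ℕ} (hM : 0 < M) (y : unitInterval) (i : Fin (M + 1)) :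
    (y : ℝ) ∈ Set.Ico ((gridPoint M i : ℝ) - 1 / M / 2) ((gridPoint M i : ℝ) + 1 / M / 2) ↔
      i = cellIndex M y := by
  have hM' : (0 : ℝ) < M := by exact_mod_cast hM
  have h0 : 0 ≤ (M : ℝ) * y := mul_nonneg (by positivity) y.2.1
  have e1 : ((gridPoint M i : ℝ) - 1 / M / 2) = ((i : ℕ) - 1 / 2) / M := by
    simp only [gridPoint]; ring
  have e2 : ((gridPoint M i : ℝ) + 1 / M / 2) = ((i : ℕ) + 1 / 2) / M := by
    simp only [gridPoint]; ring
  rw [Set.mem_Ico, e1, e2, div_le_iff₀ hM', lt_div_iff₀ hM', Fin.ext_iff, eq_comm]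
  simp only [cellIndex]
  rw [Nat.floor_eq_iff (by positivity)]
  constructor <;> rintro ⟨h1, h2⟩ <;> constructor <;> linarith

theorem dist_gridPoint_cellIndex {M : ℕ} (hM : 0 < M) (y : unitInterval) :
    dist (gridPoint M (cellIndex M y)) y ≤ 1 / M := by
  obtain ⟨h1, h2⟩ := (mem_cell_iff hM y _).2 rfl
  have : (0 : ℝ) < 1 / M := by positivity
  rw [Subtype.dist_eq, Real.dist_eq, abs_le]
  constructor <;> linarith

theorem interpolant_eq {M : ℕ} (hM : 0 < M) (u : Fin (M + 1) → ℝ) (y : unitInterval) :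
    interpolant M u y = u (cellIndex M y) := by
  rw [interpolant, Finset.sum_eq_single (cellIndex M y)]
  · exact Set.indicator_of_mem ((mem_cell_iff hM y _).2 rfl) _
  · exact fun i _ hi => Set.indicator_of_notMem (fun h => hi ((mem_cell_iff hM y i).1 h)) _
  · simp

theorem gridPoint_of_eq_add_one {M : ℕ} {i j : Fin (M + 1)} (h : (j : ℕ) = i + 1) :
    (gridPoint M j : ℝ) = gridPoint M i + 1 / M := by
  simp only [gridPoint, h]
  push_cast
  ring

/-! ### Relaxed limits -/

/-- Grid functions for all mesh sizes at once are functions on this type. -/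
abbrev Grid : Type := Σ M : ℕ, Fin (M + 1)

/-- Grid points that converge to `x` as the mesh size goes to zero. -/
def gridFilter (x : unitInterval) : Filter Grid :=
  comap (fun q : Grid => (q.1, gridPoint q.1 q.2)) (atTop ×ˢ 𝓝 x)

/-- The cell containing `y` has its grid point within one mesh width of `y`. This shows that
`gridFilter x` is nontrivial and later carries limits of grid functions over to interpolants. -/
theorem tendsto_cellIndex (x : unitInterval) :
    Tendsto (fun p : ℕ × unitInterval => (⟨p.1, cellIndex p.1 p.2⟩ : Grid)) (atTop ×ˢ 𝓝 x)
      (gridFilter x) := by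
  rw [gridFilter, tendsto_comap_iff]
  refine tendsto_fst.prodMk ?_
  have h1 : Tendsto (fun p : ℕ × unitInterval => dist (gridPoint p.1 (cellIndex p.1 p.2)) p.2)
      (atTop ×ˢ 𝓝 x) (𝓝 0) := by
    refine squeeze_zero' (Eventually.of_forall fun _ => dist_nonneg) ?_
      (tendsto_one_div_atTop_nhds_zero_nat.comp tendsto_fst)
    filter_upwards [tendsto_fst.eventually (eventually_gt_atTop 0)] with p hp
    exact dist_gridPoint_cellIndex hp p.2
  exact tendsto_snd.congr_dist (by simpa only [dist_comm] using h1)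

instance (x : unitInterval) : (gridFilter x).NeBot := (tendsto_cellIndex x).neBot

theorem tendsto_gridPoint (x : unitInterval) :
    Tendsto (fun q : Grid => gridPoint q.1 q.2) (gridFilter x) (𝓝 x) :=
  tendsto_snd.comp tendsto_comap

theorem tendsto_fst_gridFilter (x : unitInterval) :
    Tendsto (fun q : Grid => q.1) (gridFilter x) atTop :=
  tendsto_fst.comp tendsto_comap

/-- The analogue of `eventually_eventually_nhds`; it is what makes relaxed limits semicontinuous. -/
theorem eventually_eventually_gridFilter {x : unitInterval} {P : Grid → Prop}
    (h : ∀ᶠ q in gridFilter x, P q) : ∀ᶠ y in 𝓝 x, ∀ᶠ q in gridFilter y, P q := by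
  rw [gridFilter, eventually_comap, eventually_prod_iff] at h
  obtain ⟨pa, ha, pb, hb, hP⟩ := h
  filter_upwards [eventually_eventually_nhds.2 hb] with y hy
  rw [gridFilter, eventually_comap, eventually_prod_iff]
  exact ⟨pa, ha, pb, hy, hP⟩

/-- The upper relaxed limit of a family of grid functions. -/
def upperLimit (w : Grid → ℝ) (x : unitInterval) : ℝ := limsup w (gridFilter x)

section Relaxed

variable {w : Grid → ℝ} {C : ℝ}

theorem isBoundedUnder_le_of_abs_le {α : Type*} {f : α → ℝ} (hf : ∀ a, |f a| ≤ C) (l : Filter α) :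
    IsBoundedUnder (· ≤ ·) l f :=
  isBoundedUnder_of ⟨C, fun a => (abs_le.1 (hf a)).2⟩

theorem isBoundedUnder_ge_of_abs_le {α : Type*} {f : α → ℝ} (hf : ∀ a, |f a| ≤ C) (l : Filter α) :
    IsBoundedUnder (· ≥ ·) l f :=
  isBoundedUnder_of ⟨-C, fun a => (abs_le.1 (hf a)).1⟩

theorem eventually_lt_of_upperLimit_lt (hw : ∀ q, |w q| ≤ C) {x : unitInterval} {a : ℝ}
    (h : upperLimit w x < a) : ∀ᶠ q in gridFilter x, w q < a :=
  eventually_lt_of_limsup_lt h (isBoundedUnder_le_of_abs_le hw _)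

theorem frequently_lt_of_lt_upperLimit (hw : ∀ q, |w q| ≤ C) {x : unitInterval} {a : ℝ}
    (h : a < upperLimit w x) : ∃ᶠ q in gridFilter x, a < w q :=
  frequently_lt_of_lt_limsup (isBoundedUnder_ge_of_abs_le hw _).isCoboundedUnder_le h

theorem upperLimit_le (hw : ∀ q, |w q| ≤ C) {x : unitInterval} {a : ℝ}
    (h : ∀ᶠ q in gridFilter x, w q ≤ a) : upperLimit w x ≤ a :=
  limsup_le_of_le (isBoundedUnder_ge_of_abs_le hw _).isCoboundedUnder_le h

theorem le_upperLimit (hw : ∀ q, |w q| ≤ C) {x : unitInterval} {a : ℝ}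
    (h : ∃ᶠ q in gridFilter x, a ≤ w q) : a ≤ upperLimit w x :=
  le_limsup_of_frequently_le h (isBoundedUnder_le_of_abs_le hw _)

theorem abs_upperLimit_le (hw : ∀ q, |w q| ≤ C) (x : unitInterval) : |upperLimit w x| ≤ C :=
  abs_le.2 ⟨le_upperLimit hw (Eventually.of_forall fun q => (abs_le.1 (hw q)).1).frequently,
    upperLimit_le hw (Eventually.of_forall fun q => (abs_le.1 (hw q)).2)⟩

theorem upperSemicontinuous_upperLimit (hw : ∀ q, |w q| ≤ C) :
    UpperSemicontinuous (upperLimit w) := by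
  intro x a ha
  obtain ⟨b, hb, hba⟩ := exists_between ha
  filter_upwards [eventually_eventually_gridFilter (eventually_lt_of_upperLimit_lt hw hb)] with y hy
  exact (upperLimit_le hw (hy.mono fun _ => le_of_lt)).trans_lt hba

/-- The left side is the lower relaxed limit, encoded by negation so that each fact about upper
limits serves both cases. -/
theorem neg_upperLimit_neg_le (hw : ∀ q, |w q| ≤ C) (x : unitInterval) :
    -upperLimit (fun q => -w q) x ≤ upperLimit w x := by
  have hw' : ∀ q, |-w q| ≤ C := fun q => by rw [abs_neg]; exact hw q
  refine le_of_forall_pos_le_add fun ε hε => ?_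
  have hε2 : 0 < ε / 2 := by linarith
  obtain ⟨q, h1, h2⟩ := ((eventually_lt_of_upperLimit_lt hw
    (lt_add_of_pos_right (upperLimit w x) hε2)).and (eventually_lt_of_upperLimit_lt hw'
      (lt_add_of_pos_right (upperLimit (fun q => -w q) x) hε2))).exists
  linarith

/-- A strict local maximum of the relaxed limit minus a test function is approximated by local
maxima of the grid functions minus the test function. -/
theorem frequently_isMax_of_isLocalMax (hw : ∀ q, |w q| ≤ C) {φ : unitInterval → ℝ}
    (hφ : Continuous φ) {x : unitInterval}
    (hmax : IsLocalMax (fun y => upperLimit w y - φ y) x) {ε : ℝ} (hε : 0 < ε) :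
    ∃ᶠ q in gridFilter x, |w q - upperLimit w x| < ε ∧
      ∀ j : Fin (q.1 + 1), (j : ℕ) ≤ q.2 + 1 → (q.2 : ℕ) ≤ j + 1 →
        w ⟨q.1, j⟩ - (φ (gridPoint q.1 j) + ((gridPoint q.1 j : ℝ) - x) ^ 4) ≤
          w q - (φ (gridPoint q.1 q.2) + ((gridPoint q.1 q.2 : ℝ) - x) ^ 4) := by
  set ψ : unitInterval → ℝ := fun y => φ y + ((y : ℝ) - x) ^ 4 with hψ
  have hψc : Continuous ψ := by fun_prop
  have hψx : ψ x = φ x := by simp [hψ]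
  intro hnot
  rw [gridFilter, eventually_comap] at hnot
  obtain ⟨δ₀, hδ₀, hball⟩ := Metric.eventually_nhds_iff.1 hmax
  -- near `x` the grid functions are not much larger than the relaxed limit
  have hup : ∀ᶠ p in atTop ×ˢ 𝓝 x, ∀ q : Grid, (q.1, gridPoint q.1 q.2) = p →
      w q < upperLimit w x + ε :=
    eventually_comap.1 (eventually_lt_of_upperLimit_lt hw (lt_add_of_pos_right _ hε))
  have hψn : ∀ᶠ p : ℕ × unitInterval in atTop ×ˢ 𝓝 x, |ψ p.2 - ψ x| < ε / 4 :=
    tendsto_snd.eventually (Metric.continuousAt_iff'.1 hψc.continuousAt (ε / 4) (by linarith))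
  obtain ⟨pa, ha, pb, hb, hP⟩ := eventually_prod_iff.1 ((hnot.and hup).and hψn)
  obtain ⟨δ₁, hδ₁, hball₁⟩ := Metric.eventually_nhds_iff.1 hb
  -- The ball of radius `2ρ` stays where the maximum is valid. The annulus from `ρ` to `2ρ` is wider
  -- than the mesh, so a maximizer found inside radius `ρ` has its neighbours inside `2ρ`.
  set ρ : ℝ := min δ₀ δ₁ / 3 with hρ
  have hρ0 : 0 < ρ := by positivity
  have hρδ₀ : 2 * ρ < δ₀ := by have := min_le_left δ₀ δ₁; linarith
  have hρδ₁ : ρ < δ₁ := by have := min_le_right δ₀ δ₁; linarith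
  set m := upperLimit w x - ψ x with hm
  -- on the annulus the grid functions minus the test function stay below the maximum
  set A : Set unitInterval := {y | ρ ≤ dist y x ∧ dist y x ≤ 2 * ρ} with hA
  have hAc : IsCompact A := by
    have hc : Continuous fun y : unitInterval => dist y x := by fun_prop
    exact ((isClosed_le continuous_const hc).inter (isClosed_le hc continuous_const)).isCompact
  have hAm : {p : ℕ × unitInterval | ∀ q : Grid, (q.1, gridPoint q.1 q.2) = p →
      w q - ψ (gridPoint q.1 q.2) < m - ρ ^ 4 / 4} ∈ atTop ×ˢ 𝓝ˢ A := by
    refine hAc.mem_prod_nhdsSet_of_forall fun y hy => ?_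
    suffices h : ∀ᶠ q in gridFilter y, w q - ψ (gridPoint q.1 q.2) < m - ρ ^ 4 / 4 from
      eventually_comap.1 h
    -- The quartic costs at least `ρ ^ 4` on the annulus; semicontinuity and continuity of `ψ` lose
    -- at most `ρ ^ 4 / 4` each. Compactness made this uniform over the annulus.
    have h1 : upperLimit w y - φ y ≤ upperLimit w x - φ x := hball (hy.2.trans_lt hρδ₀)
    have h2 : ρ ^ 4 ≤ ((y : ℝ) - x) ^ 4 := by
      have := pow_le_pow_left₀ hρ0.le hy.1 4
      rwa [Subtype.dist_eq, Real.dist_eq, Even.pow_abs (by decide)] at this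
    have h4 : 0 < ρ ^ 4 / 4 := by positivity
    have h3 := (hψc.tendsto y).comp (tendsto_gridPoint y)
    filter_upwards [eventually_lt_of_upperLimit_lt hw (lt_add_of_pos_right _ h4),
      h3.eventually (lt_mem_nhds (sub_lt_self (ψ y) h4))] with q hq1 hq2
    simp only [Function.comp] at hq2
    have h5 : ψ y = φ y + ((y : ℝ) - x) ^ 4 := rfl
    linarith
  obtain ⟨pc, hc, pd, hd, hP'⟩ := eventually_prod_iff.1 hAm
  have hd : ∀ y ∈ A, pd y := fun y hy => mem_of_mem_nhds (eventually_nhdsSet_iff_forall.1 hd y hy)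
  -- a grid point where the maximum is almost attained
  set t := min (ρ ^ 4 / 8) (ε / 4) with ht
  have ht0 : 0 < t := by positivity
  have hfreq := frequently_lt_of_lt_upperLimit hw (sub_lt_self (upperLimit w x) ht0)
  have hψt := ((hψc.tendsto x).comp (tendsto_gridPoint x)).eventually
    (gt_mem_nhds (lt_add_of_pos_right (ψ x) ht0))
  have hgx := (tendsto_gridPoint x).eventually (Metric.ball_mem_nhds x hρ0)
  have hM : ∀ᶠ M : ℕ in atTop, 1 / (M : ℝ) < ρ :=
    tendsto_one_div_atTop_nhds_zero_nat.eventually (gt_mem_nhds hρ0)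
  obtain ⟨⟨M, i₀⟩, hi₁, ⟨hi₂, hi₃⟩, ⟨hMa, hMc⟩, hMρ⟩ := (hfreq.and_eventually
    ((hψt.and hgx).and
      ((tendsto_fst_gridFilter x).eventually ((ha.and hc).and hM)))).exists
  simp only [Function.comp] at hi₂ hi₃ hMa hMc hMρ
  obtain ⟨i, hi, himax⟩ := Finset.exists_max_image
    (Finset.univ.filter fun i : Fin (M + 1) => dist (gridPoint M i) x ≤ 2 * ρ)
    (fun i => w ⟨M, i⟩ - ψ (gridPoint M i)) ⟨i₀, by simp; linarith⟩
  simp only [Finset.mem_filter, Finset.mem_univ, true_and] at hi himax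
  -- As `2 * t ≤ ρ ^ 4 / 4`, this excludes the annulus; as `2 * t ≤ ε / 2`, it keeps `w` within `ε`
  -- below the relaxed limit.
  have hval : m - 2 * t < w ⟨M, i⟩ - ψ (gridPoint M i) := by
    have := himax i₀ (by linarith)
    linarith
  have hclose : dist (gridPoint M i) x < ρ := by
    by_contra! hge
    have h1 := hP' hMc (hd _ ⟨hge, hi⟩) ⟨M, i⟩ rfl
    have h2 := min_le_left (ρ ^ 4 / 8) (ε / 4)
    simp only at h1
    linarith
  obtain ⟨⟨h1, h2⟩, h3⟩ := hP hMa (hball₁ (hclose.trans hρδ₁))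
  refine h1 ⟨M, i⟩ rfl ⟨?_, fun j hj1 hj2 => himax j ?_⟩
  · have h4 := h2 ⟨M, i⟩ rfl
    have h5 := min_le_right (ρ ^ 4 / 8) (ε / 4)
    rw [abs_lt] at h3 ⊢
    simp only at h3
    constructor <;> linarith
  · have h6 : dist (gridPoint M j) (gridPoint M i) ≤ 1 / M := by
      rw [Subtype.dist_eq, Real.dist_eq]
      simp only [gridPoint]
      rw [← sub_div, abs_div, Nat.abs_cast]
      refine div_le_div_of_nonneg_right ?_ (Nat.cast_nonneg M)
      have h7 : ((j : ℕ) : ℝ) ≤ (i : ℕ) + 1 := by exact_mod_cast hj1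
      have h8 : ((i : ℕ) : ℝ) ≤ (j : ℕ) + 1 := by exact_mod_cast hj2
      rw [abs_le]
      constructor <;> linarith
    have := dist_triangle (gridPoint M j) (gridPoint M i) x
    linarith

end Relaxed

/-! ### Consistency of the difference quotients -/

/-- The mean value theorem turns the quotients into derivatives at intermediate points. The base
point `y` may vary near `x`, as grid points do. -/
theorem exists_delta_differenceQuotients {ψ : ℝ → ℝ} (hψ : ContDiff ℝ 2 ψ) (x : ℝ) {ε : ℝ}
    (hε : 0 < ε) : ∃ δ > 0, ∀ y h : ℝ, |y - x| < δ → 0 < h → h < δ →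
      |(ψ (y + h) - ψ y) / h - deriv ψ x| < ε ∧ |(ψ (y - h) - ψ y) / h + deriv ψ x| < ε ∧
      |(ψ (y + h) + ψ (y - h) - 2 * ψ y) / h ^ 2 - deriv (deriv ψ) x| < ε := by
  have hd : Differentiable ℝ ψ := hψ.differentiable (by norm_num)
  have hψ1 : ContDiff ℝ 1 (deriv ψ) := by
    rw [show (2 : WithTop ℕ∞) = 1 + 1 by norm_num] at hψ
    exact (contDiff_succ_iff_deriv.1 hψ).2.2
  have hd1 : Differentiable ℝ (deriv ψ) := hψ1.differentiable (by norm_num)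
  have hc2 : Continuous (deriv (deriv ψ)) := hψ1.continuous_deriv le_rfl
  have hmv : ∀ f : ℝ → ℝ, Differentiable ℝ f → ∀ a h : ℝ, 0 < h →
      ∃ ξ, a < ξ ∧ ξ < a + h ∧ f (a + h) - f a = deriv f ξ * h := fun f hf a h hh => by
    obtain ⟨ξ, hξ, he⟩ := exists_deriv_eq_slope f (show a < a + h by linarith)
      hf.continuous.continuousOn hf.differentiableOn
    refine ⟨ξ, hξ.1, hξ.2, ?_⟩
    rw [he, add_sub_cancel_left, div_mul_cancel₀ _ hh.ne']
  obtain ⟨δ₁, hδ₁, h₁⟩ := Metric.continuousAt_iff.1 hd1.continuous.continuousAt ε hε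
  obtain ⟨δ₂, hδ₂, h₂⟩ := Metric.continuousAt_iff.1 hc2.continuousAt ε hε
  simp only [Real.dist_eq] at h₁ h₂
  refine ⟨min δ₁ δ₂ / 2, by positivity, fun y h hy hh hhδ => ?_⟩
  have hm1 := min_le_left δ₁ δ₂
  have hm2 := min_le_right δ₁ δ₂
  rw [abs_lt] at hy
  refine ⟨?_, ?_, ?_⟩
  · obtain ⟨ξ, h1, h2, h3⟩ := hmv ψ hd y h hh
    rw [h3, mul_div_cancel_right₀ _ hh.ne']
    exact h₁ (abs_lt.2 ⟨by linarith, by linarith⟩)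
  · obtain ⟨ξ, h1, h2, h3⟩ := hmv ψ hd (y - h) h hh
    rw [sub_add_cancel] at h3
    rw [← neg_sub (ψ y), h3, neg_div, mul_div_cancel_right₀ _ hh.ne', ← abs_neg]
    convert h₁ (x := ξ) (abs_lt.2 ⟨by linarith, by linarith⟩) using 2
    ring
  -- The second difference is a first difference of `s ↦ ψ (s + h) - ψ s`, so two applications of
  -- the mean value theorem suffice.
  · have hG : ∀ s, HasDerivAt (fun s => ψ (s + h) - ψ s) (deriv ψ (s + h) - deriv ψ s) s :=
      fun s => ((hd (s + h)).hasDerivAt.comp_add_const s h).sub (hd s).hasDerivAt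
    obtain ⟨ξ, h1, h2, h3⟩ := hmv (fun s => ψ (s + h) - ψ s)
      (fun s => (hG s).differentiableAt) (y - h) h hh
    rw [(hG ξ).deriv] at h3
    obtain ⟨ζ, h4, h5, h6⟩ := hmv (deriv ψ) hd1 ξ h hh
    rw [h6, sub_add_cancel] at h3
    have h7 : (ψ (y + h) + ψ (y - h) - 2 * ψ y) / h ^ 2 = deriv (deriv ψ) ζ := by
      rw [div_eq_iff (by positivity)]
      linarith
    rw [h7]
    exact h₂ (abs_lt.2 ⟨by linarith, by linarith⟩)

/-- Adding or subtracting a quartic does not change the derivatives up to order two. -/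
theorem deriv_add_const_mul_pow_four {φ : ℝ → ℝ} (hφ : ContDiff ℝ 2 φ) (s x : ℝ) :
    ContDiff ℝ 2 (fun y => φ y + s * (y - x) ^ 4) ∧
      deriv (fun y => φ y + s * (y - x) ^ 4) x = deriv φ x ∧
      deriv (deriv fun y => φ y + s * (y - x) ^ 4) x = deriv (deriv φ) x := by
  have hd : Differentiable ℝ φ := hφ.differentiable (by norm_num)
  have hψ1 : ContDiff ℝ 1 (deriv φ) := by
    rw [show (2 : WithTop ℕ∞) = 1 + 1 by norm_num] at hφ
    exact (contDiff_succ_iff_deriv.1 hφ).2.2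
  have hd1 : Differentiable ℝ (deriv φ) := hψ1.differentiable (by norm_num)
  have h1 : deriv (fun y => φ y + s * (y - x) ^ 4) =
      fun y => deriv φ y + s * (4 * (y - x) ^ 3) := by
    ext y
    have := (hd y).hasDerivAt.add ((((hasDerivAt_id y).sub_const x).pow 4).const_mul s)
    simpa using! this.deriv
  refine ⟨by fun_prop, by simp [h1], ?_⟩
  rw [h1]
  have := (hd1 x).hasDerivAt.add
    (((((hasDerivAt_id x).sub_const x).pow 3).const_mul 4).const_mul s)
  simpa using! this.deriv

variable {c : Coeffs Λ} {S : Finset Λ} {M : ℕ} {u : Fin (M + 1) → ℝ}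

/-! ### The scheme against test functions -/

theorem hjbOp_of_interior {x : unitInterval} (hx : ¬(x = 0 ∨ x = 1)) (r p X : ℝ) :
    hjbOp c (x, r, p, X) = -(⨆ γ : ℝ≥0, ⨆ l : Λ,
      ((1 / 2 * c.σ x l ^ 2 * X + c.μ x l * p - c.η x * r
        - 1 / 2 * c.α x * (γ : ℝ) ^ 2 * r + c.β x * (γ : ℝ) : ℝ) : EReal)) :=
  if_neg hx

theorem gridPoint_interior {i : Fin (M + 1)} (hi : 0 < (i : ℕ) ∧ (i : ℕ) < M) :
    ¬(gridPoint M i = 0 ∨ gridPoint M i = 1) := by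
  have h0 : (0 : ℝ) < (i : ℕ) := by exact_mod_cast hi.1
  have h1 : ((i : ℕ) : ℝ) < M := by exact_mod_cast hi.2
  rw [Subtype.ext_iff, Subtype.ext_iff]
  simp only [gridPoint, Set.Icc.coe_zero, Set.Icc.coe_one]
  rintro (h | h)
  · exact (div_pos h0 (h0.trans h1)).ne' h
  · rw [div_eq_one_iff_eq (h0.trans h1).ne'] at h
    exact h1.ne h

theorem gridPoint_boundary (hM : 0 < M) {i : Fin (M + 1)} (hi : ¬(0 < (i : ℕ) ∧ (i : ℕ) < M)) :
    gridPoint M i = 0 ∨ gridPoint M i = 1 := by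
  have hM' : (M : ℝ) ≠ 0 := by positivity
  have : (i : ℕ) = 0 ∨ (i : ℕ) = M := by omega
  rw [Subtype.ext_iff, Subtype.ext_iff]
  simp only [gridPoint, Set.Icc.coe_zero, Set.Icc.coe_one]
  rcases this with h | h
  · left; simp [h]
  · right; rw [h, div_self hM']

theorem hjbOp_boundary (hM : 0 < M) (hg : ∀ x, 0 < c.g x) (hu : IsPositiveSolution c S M u)
    {i : Fin (M + 1)} (hi : ¬(0 < (i : ℕ) ∧ (i : ℕ) < M)) (p X : ℝ) :
    hjbOp c (gridPoint M i, u i, p, X) = 0 := by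
  rw [isPositiveSolution_iff c S hM] at hu
  obtain ⟨l, -, hl⟩ := (hu.2 i).1
  have h : u i = c.g (gridPoint M i) := by
    simp only [quadOp, schemeWeight, schemeDiag, schemeVec, hi, if_false, zero_mul,
      Finset.sum_const_zero, zero_add, one_mul] at hl
    rw [← sq] at hl
    exact (pow_left_inj₀ (hu.1 i).le (hg _).le two_ne_zero).1 hl
  have : hjbOp c (gridPoint M i, u i, p, X) = ((u i - c.g (gridPoint M i) : ℝ) : EReal) :=
    if_pos (gridPoint_boundary hM hi)
  rw [this, h, sub_self, EReal.coe_zero]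

/-- The difference quotients of `ψ` at the grid point `y` with step `h` are `ε`-close to `P`
and `X`. -/
def QuotientsNear (ψ : ℝ → ℝ) (y h P X ε : ℝ) : Prop :=
  |(ψ (y + h) - ψ y) / h - P| < ε ∧ |(ψ (y - h) - ψ y) / h + P| < ε ∧
    |(ψ (y + h) + ψ (y - h) - 2 * ψ y) / h ^ 2 - X| < ε

/-- Consistency of the upwind discretization. -/
theorem abs_sum_schemeWeight_sub_le {ψ : ℝ → ℝ} {P X ε C : ℝ} {i : Fin (M + 1)}
    (hi : 0 < (i : ℕ) ∧ (i : ℕ) < M) {l : Λ} (hσ : |c.σ (gridPoint M i) l| ≤ C)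
    (hμ : |c.μ (gridPoint M i) l| ≤ C) (hq : QuotientsNear ψ (gridPoint M i) (1 / M) P X ε) :
    |∑ j, schemeWeight c M i l j * (ψ (gridPoint M j) - ψ (gridPoint M i)) -
      (1 / 2 * c.σ (gridPoint M i) l ^ 2 * X + c.μ (gridPoint M i) l * P)| ≤
      (C ^ 2 / 2 + C) * ε := by
  have hM : (M : ℝ) ≠ 0 := by have := hi.1.trans hi.2; positivity
  obtain ⟨h1, h2, h3⟩ := hq
  have hn := gridPoint_of_eq_add_one (M := M) (i := i) (j := ⟨i + 1, by omega⟩) rfl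
  have hp := gridPoint_of_eq_add_one (M := M) (i := ⟨i - 1, by omega⟩) (j := i)
    (by simp; omega)
  rw [sum_schemeWeight_mul c M i ⟨i - 1, by omega⟩ ⟨i + 1, by omega⟩ (by simp; omega) rfl,
    hn, ← sub_eq_iff_eq_add.2 hp]
  set y : ℝ := ↑(gridPoint M i)
  set s := c.σ (gridPoint M i) l
  set m := c.μ (gridPoint M i) l
  have hm : max m 0 - max (-m) 0 = m := max_zero_sub_eq_self m
  have hma : max m 0 + max (-m) 0 = |m| := max_zero_add_max_neg_zero_eq_abs_self m
  -- Writing the drift as its positive minus its negative part, the consistency error becomes a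
  -- nonnegative combination of the three quotient errors.
  have e : (1 / 2 * s ^ 2 * (M : ℝ) ^ 2 + max (-m) 0 * M) * (ψ (y - 1 / M) - ψ y) +
      (1 / 2 * s ^ 2 * (M : ℝ) ^ 2 + max m 0 * M) * (ψ (y + 1 / M) - ψ y) -
      (1 / 2 * s ^ 2 * X + m * P) =
      1 / 2 * s ^ 2 * ((ψ (y + 1 / M) + ψ (y - 1 / M) - 2 * ψ y) / (1 / M) ^ 2 - X) +
      max (-m) 0 * ((ψ (y - 1 / M) - ψ y) / (1 / M) + P) +
      max m 0 * ((ψ (y + 1 / M) - ψ y) / (1 / M) - P) := by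
    have hmP : m * P = (max m 0 - max (-m) 0) * P := by rw [hm]
    rw [hmP]
    generalize ψ (y + 1 / M) = a, ψ (y - 1 / M) = b, ψ y = d, max m 0 = m₁, max (-m) 0 = m₂
    field_simp
    ring
  have hε : 0 ≤ ε := (abs_nonneg _).trans h1.le
  have hs2 : s ^ 2 ≤ C ^ 2 := by
    rw [← sq_abs s]
    exact pow_le_pow_left₀ (abs_nonneg _) hσ 2
  rw [e]
  refine (abs_add_three _ _ _).trans ?_
  rw [abs_mul (1 / 2 * s ^ 2), abs_mul (max _ _), abs_mul (max _ _), abs_of_nonneg (show 0 ≤ 1 / 2 * s ^ 2 by positivity),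
    abs_of_nonneg (le_max_right (-m) 0), abs_of_nonneg (le_max_right m 0)]
  have k1 := mul_le_mul_of_nonneg_left h3.le (show 0 ≤ 1 / 2 * s ^ 2 by positivity)
  have k2 := mul_le_mul_of_nonneg_left h2.le (le_max_right (-m) 0)
  have k3 := mul_le_mul_of_nonneg_left h1.le (le_max_right m 0)
  have k4 : (1 / 2 * s ^ 2 + (max m 0 + max (-m) 0)) * ε ≤ (C ^ 2 / 2 + C) * ε := by
    rw [hma]
    exact mul_le_mul_of_nonneg_right (by linarith) hε
  linarith

theorem weight_mul_le_of_neighbour {i : Fin (M + 1)} {l : Λ} {f f' : Fin (M + 1) → ℝ}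
    (h : ∀ j : Fin (M + 1), (j : ℕ) ≤ i + 1 → (i : ℕ) ≤ j + 1 → f j ≤ f' j) :
    ∑ j, schemeWeight c M i l j * f j ≤ ∑ j, schemeWeight c M i l j * f' j := by
  refine Finset.sum_le_sum fun j _ => ?_
  by_cases hj : (j : ℕ) ≤ i + 1 ∧ (i : ℕ) ≤ j + 1
  · exact mul_le_mul_of_nonneg_left (h j hj.1 hj.2) (schemeWeight_nonneg _ _ _ _ _)
  · have h1 : (j : ℕ) + 1 ≠ i := by omega
    have h2 : (j : ℕ) ≠ i + 1 := by omega
    simp [schemeWeight, h1, h2]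

/-- To bound minus a supremum above, one pair of controls suffices: the optimal discrete `l`,
together with `γ = β / (α u i)`. -/
theorem hjbOp_le_of_isMax (hM : 0 < M) (hα : ∀ x, 0 < c.α x) (hβ : ∀ x, 0 < c.β x)
    (hg : ∀ x, 0 < c.g x) {C : ℝ} (hσ : ∀ x l, |c.σ x l| ≤ C) (hμ : ∀ x l, |c.μ x l| ≤ C)
    (hu : IsPositiveSolution c S M u) {i : Fin (M + 1)} {ψ : ℝ → ℝ} {P X ε : ℝ}
    (hq : QuotientsNear ψ (gridPoint M i) (1 / M) P X ε)
    (hmax : ∀ j : Fin (M + 1), (j : ℕ) ≤ i + 1 → (i : ℕ) ≤ j + 1 →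
      u j - ψ (gridPoint M j) ≤ u i - ψ (gridPoint M i)) :
    hjbOp c (gridPoint M i, u i, P, X) ≤ (((C ^ 2 / 2 + C) * ε : ℝ) : EReal) := by
  by_cases hi : 0 < (i : ℕ) ∧ (i : ℕ) < M
  swap
  · rw [hjbOp_boundary hM hg hu hi, EReal.coe_nonneg]
    obtain ⟨l, -⟩ := ((isPositiveSolution_iff c S hM u).1 hu |>.2 i).1
    have hC := (abs_nonneg _).trans (hσ 0 l)
    have hε := (abs_nonneg _).trans hq.1.le
    positivity
  rw [hjbOp_of_interior (gridPoint_interior hi)]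
  rw [isPositiveSolution_iff c S hM] at hu
  obtain ⟨l, -, hl⟩ := (hu.2 i).1
  have hr := hu.1 i
  set x := gridPoint M i with hx
  have hαx := hα x
  have hβx := hβ x
  simp only [quadOp, schemeDiag, schemeVec, hi, and_self, if_true, ← hx] at hl
  have h1 := weight_mul_le_of_neighbour (c := c) (l := l) (i := i)
    (f := fun j => u j - u i) (f' := fun j => ψ (gridPoint M j) - ψ x)
    fun j h h' => by have := hmax j h h'; linarith
  have h2 := abs_le.1 (abs_sum_schemeWeight_sub_le hi (hσ _ l) (hμ _ l) hq)
  rw [← hx] at h2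
  have h3 : ∑ j, schemeWeight c M i l j * (u i - u j) =
      -∑ j, schemeWeight c M i l j * (u j - u i) := by
    rw [← Finset.sum_neg_distrib]
    exact Finset.sum_congr rfl fun _ _ => by ring
  have hγ : 0 ≤ c.β x / (c.α x * u i) := by positivity
  rw [EReal.neg_le]
  refine le_trans ?_ (le_iSup₂ (NNReal.mk (c.β x / (c.α x * u i)) hγ) l)
  rw [← EReal.coe_neg, EReal.coe_le_coe_iff, NNReal.coe_mk]
  have h4 : ∑ j, schemeWeight c M i l j * (u i - u j) + c.η x * u i =
      c.β x / (c.α x * u i) * c.β x / 2 := by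
    field_simp
    field_simp at hl
    linarith
  have h5 : 1 / 2 * c.α x * (c.β x / (c.α x * u i)) ^ 2 * u i =
      c.β x / (c.α x * u i) * c.β x / 2 := by
    field_simp
  rw [h5]
  linarith [h2.1]

/-- Here every `(γ, l)` must be handled. Replacing `l` by a nearby `l' ∈ S` costs the terms in `|X|`
and `|P|`, and completing a square handles `γ`. -/
theorem le_hjbOp_of_isMin (hM : 0 < M) (hα : ∀ x, 0 < c.α x)
    (hg : ∀ x, 0 < c.g x) {C : ℝ} (hσ : ∀ x l, |c.σ x l| ≤ C) (hμ : ∀ x l, |c.μ x l| ≤ C)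
    (hu : IsPositiveSolution c S M u) {i : Fin (M + 1)} {ψ : ℝ → ℝ} {P X ε : ℝ}
    (hS : ∀ l, ∃ l' ∈ S, ∀ x, |c.σ x l - c.σ x l'| < ε ∧ |c.μ x l - c.μ x l'| < ε)
    (hq : QuotientsNear ψ (gridPoint M i) (1 / M) P X ε)
    (hmin : ∀ j : Fin (M + 1), (j : ℕ) ≤ i + 1 → (i : ℕ) ≤ j + 1 →
      u i - ψ (gridPoint M i) ≤ u j - ψ (gridPoint M j)) :
    ((-((C ^ 2 / 2 + C + C * |X| + |P|) * ε) : ℝ) : EReal) ≤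
      hjbOp c (gridPoint M i, u i, P, X) := by
  have hε : 0 ≤ ε := (abs_nonneg _).trans hq.1.le
  by_cases hi : 0 < (i : ℕ) ∧ (i : ℕ) < M
  swap
  · rw [hjbOp_boundary hM hg hu hi, ← EReal.coe_zero, EReal.coe_le_coe_iff]
    obtain ⟨l, -⟩ := ((isPositiveSolution_iff c S hM u).1 hu |>.2 i).1
    have hC := (abs_nonneg _).trans (hσ 0 l)
    rw [neg_nonpos]
    positivity
  rw [hjbOp_of_interior (gridPoint_interior hi)]
  rw [isPositiveSolution_iff c S hM] at hu
  have hr := hu.1 i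
  set x := gridPoint M i with hx
  have hαx := hα x
  rw [EReal.le_neg, ← EReal.coe_neg, neg_neg]
  refine iSup₂_le fun γ l => ?_
  rw [EReal.coe_le_coe_iff]
  obtain ⟨l', hl', hll'⟩ := hS l
  obtain ⟨hσl, hμl⟩ := hll' x
  have hl := (hu.2 i).2 ⟨l', hl', rfl⟩
  simp only [quadOp, schemeDiag, schemeVec, hi, and_self, if_true, ← hx] at hl
  have h1 := weight_mul_le_of_neighbour (c := c) (l := l') (i := i)
    (f := fun j => ψ (gridPoint M j) - ψ x) (f' := fun j => u j - u i)
    fun j h h' => by have := hmin j h h'; linarith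
  have h2 := abs_le.1 (abs_sum_schemeWeight_sub_le hi (hσ _ l') (hμ _ l') hq)
  rw [← hx] at h2
  have h3 : ∑ j, schemeWeight c M i l' j * (u i - u j) =
      -∑ j, schemeWeight c M i l' j * (u j - u i) := by
    rw [← Finset.sum_neg_distrib]
    exact Finset.sum_congr rfl fun _ _ => by ring
  -- the supremum over `γ`
  have h4 : c.β x * γ - 1 / 2 * c.α x * (γ : ℝ) ^ 2 * u i ≤
      ∑ j, schemeWeight c M i l' j * (u i - u j) + c.η x * u i := by
    refine le_of_mul_le_mul_left (le_trans ?_ hl) hr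
    have h5 : 1 / 2 * (c.β x ^ 2 / c.α x) -
        u i * (c.β x * γ - 1 / 2 * c.α x * (γ : ℝ) ^ 2 * u i) =
        1 / 2 * ((c.β x - c.α x * γ * u i) ^ 2 / c.α x) := by
      field_simp
      ring
    have h6 : 0 ≤ 1 / 2 * ((c.β x - c.α x * γ * u i) ^ 2 / c.α x) := by positivity
    linarith
  -- the change of control
  have h7 : 1 / 2 * c.σ x l ^ 2 * X - 1 / 2 * c.σ x l' ^ 2 * X ≤ C * |X| * ε := by
    have e : 1 / 2 * c.σ x l ^ 2 * X - 1 / 2 * c.σ x l' ^ 2 * X =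
        (c.σ x l + c.σ x l') / 2 * X * (c.σ x l - c.σ x l') := by ring
    rw [e]
    refine (le_abs_self _).trans ?_
    rw [abs_mul, abs_mul]
    have hC := (abs_nonneg _).trans (hσ x l)
    have h8 : |(c.σ x l + c.σ x l') / 2| ≤ C := by
      have k1 := abs_le.1 (hσ x l)
      have k2 := abs_le.1 (hσ x l')
      rw [abs_le]
      constructor <;> linarith
    gcongr
  have h9 : c.μ x l * P - c.μ x l' * P ≤ |P| * ε := by
    rw [← sub_mul, mul_comm]
    refine (le_abs_self _).trans ?_
    rw [abs_mul]
    gcongr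
  linarith [h2.2]

/-! ### Relaxed limits of the scheme are sub- and supersolutions -/

/-- The derivative slots stay fixed at `P` and `X`; only the point and the value move. The
hypothesis is needed just for `ε' ≤ ε`, since `p` will itself involve the tolerance `ε`. -/
theorem frequently_nhds_of_gridFilter {w : Grid → ℝ} {x : unitInterval} {r P X : ℝ}
    {p : unitInterval × ℝ × ℝ × ℝ → Prop} {ε : ℝ} (hε : 0 < ε)
    (h : ∀ ε' > 0, ε' ≤ ε → ∃ᶠ q in gridFilter x, |w q - r| < ε' ∧
      p (gridPoint q.1 q.2, w q, P, X)) : ∃ᶠ z in 𝓝 (x, r, P, X), p z := by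
  intro hn
  obtain ⟨δ, hδ, hball⟩ := Metric.eventually_nhds_iff.1 hn
  obtain ⟨q, ⟨h1, h2⟩, h3⟩ := ((h (min δ ε) (by positivity) (min_le_right _ _)).and_eventually
    ((tendsto_gridPoint x).eventually (Metric.ball_mem_nhds x hδ))).exists
  refine hball ?_ h2
  simp only [Prod.dist_eq, dist_self, max_lt_iff]
  exact ⟨h3, h1.trans_le (min_le_left _ _), hδ⟩

theorem hjbLower_nonpos {w : Grid → ℝ} {x : unitInterval} {r P X : ℝ}
    (h : ∀ ε > 0, ∃ᶠ q in gridFilter x, |w q - r| < ε ∧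
      hjbOp c (gridPoint q.1 q.2, w q, P, X) ≤ (ε : EReal)) :
    hjbLower c (x, r, P, X) ≤ 0 := by
  refine le_of_forall_gt_imp_ge_of_dense fun a ha => ?_
  obtain ⟨ε, hε, hεa⟩ := EReal.lt_iff_exists_real_btwn.1 ha
  rw [EReal.coe_pos] at hε
  refine le_trans (liminf_le_of_frequently_le' ?_) hεa.le
  refine frequently_nhds_of_gridFilter (w := w) hε fun ε' hε' hle => ?_
  exact (h ε' hε').mono fun q hq => ⟨hq.1, hq.2.trans (EReal.coe_le_coe_iff.2 hle)⟩

theorem hjbUpper_nonneg {w : Grid → ℝ} {x : unitInterval} {r P X : ℝ}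
    (h : ∀ ε > 0, ∃ᶠ q in gridFilter x, |w q - r| < ε ∧
      ((-ε : ℝ) : EReal) ≤ hjbOp c (gridPoint q.1 q.2, w q, P, X)) :
    0 ≤ hjbUpper c (x, r, P, X) := by
  refine le_of_forall_lt_imp_le_of_dense fun a ha => ?_
  obtain ⟨ε, hεa, hε⟩ := EReal.lt_iff_exists_real_btwn.1 ha
  rw [← EReal.coe_zero, EReal.coe_lt_coe_iff] at hε
  refine hεa.le.trans (le_limsup_of_frequently_le' ?_)
  refine frequently_nhds_of_gridFilter (w := w) (neg_pos.2 hε) fun ε' hε' hle => ?_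
  exact (h ε' hε').mono fun q hq =>
    ⟨hq.1, (EReal.coe_le_coe_iff.2 (by linarith)).trans hq.2⟩

theorem exists_pos_mul_le (K : ℝ) {ε : ℝ} (hε : 0 < ε) : ∃ t > 0, t ≤ ε ∧ K * t ≤ ε := by
  have hK : 0 < |K| + 1 := by positivity
  refine ⟨ε / (|K| + 1), by positivity, div_le_self hε.le (by linarith [abs_nonneg K]), ?_⟩
  rw [mul_div_assoc', div_le_iff₀ hK]
  nlinarith [le_abs_self K]

theorem eventually_quotientsNear {ψ : ℝ → ℝ} (hψ : ContDiff ℝ 2 ψ) (x : unitInterval) {ε : ℝ}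
    (hε : 0 < ε) : ∀ᶠ q in gridFilter x, 0 < q.1 ∧
      QuotientsNear ψ (gridPoint q.1 q.2) (1 / q.1) (deriv ψ x) (deriv (deriv ψ) x) ε := by
  obtain ⟨δ, hδ, h⟩ := exists_delta_differenceQuotients hψ x hε
  filter_upwards [(tendsto_gridPoint x).eventually (Metric.ball_mem_nhds x hδ),
    (tendsto_fst_gridFilter x).eventually (eventually_gt_atTop 0),
    (tendsto_one_div_atTop_nhds_zero_nat.comp (tendsto_fst_gridFilter x)).eventually
      (gt_mem_nhds hδ)] with q h1 h2 h3
  exact ⟨h2, h _ _ h1 (by positivity) h3⟩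

theorem isSubsolution_upperLimit (hα : ∀ x, 0 < c.α x) (hβ : ∀ x, 0 < c.β x)
    (hg : ∀ x, 0 < c.g x) {C : ℝ} (hσ : ∀ x l, |c.σ x l| ≤ C) (hμ : ∀ x l, |c.μ x l| ≤ C)
    {S : ℕ → Finset Λ} {w : Grid → ℝ} {K : ℝ} (hw : ∀ q, |w q| ≤ K)
    (hsol : ∀ M : ℕ, 0 < M → IsPositiveSolution c (S M) M fun i => w ⟨M, i⟩) :
    IsSubsolution c (upperLimit w) := by
  refine ⟨⟨K, abs_upperLimit_le hw⟩, upperSemicontinuous_upperLimit hw, fun φ hφ x hmax => ?_⟩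
  refine hjbLower_nonpos (w := w) fun ε hε => ?_
  obtain ⟨t, ht, htε, hKt⟩ := exists_pos_mul_le (C ^ 2 / 2 + C) hε
  obtain ⟨hψ, hψ1, hψ2⟩ := deriv_add_const_mul_pow_four hφ 1 x
  have hev := eventually_quotientsNear hψ x ht
  rw [hψ1, hψ2] at hev
  refine ((frequently_isMax_of_isLocalMax hw (φ := fun y => φ y)
    (hφ.continuous.comp continuous_subtype_val) hmax ht).and_eventually hev).mono ?_
  rintro ⟨M, i⟩ ⟨⟨h1, h2⟩, hM, hq⟩
  refine ⟨h1.trans_le htε, le_trans (hjbOp_le_of_isMax hM hα hβ hg hσ hμ (hsol M hM) hq ?_)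
    (EReal.coe_le_coe_iff.2 hKt)⟩
  intro j hj hj'
  simpa only [one_mul] using h2 j hj hj'

theorem isSupersolution_neg_upperLimit_neg (hα : ∀ x, 0 < c.α x)
    (hg : ∀ x, 0 < c.g x) {C : ℝ} (hσ : ∀ x l, |c.σ x l| ≤ C) (hμ : ∀ x l, |c.μ x l| ≤ C)
    {S : ℕ → Finset Λ} (hS : ∀ ε > 0, ∀ᶠ M in atTop, ∀ l, ∃ l' ∈ S M, ∀ x,
      |c.σ x l - c.σ x l'| < ε ∧ |c.μ x l - c.μ x l'| < ε)
    {w : Grid → ℝ} {K : ℝ} (hw : ∀ q, |w q| ≤ K)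
    (hsol : ∀ M : ℕ, 0 < M → IsPositiveSolution c (S M) M fun i => w ⟨M, i⟩) :
    IsSupersolution c (fun x => -upperLimit (fun q => -w q) x) := by
  have hw' : ∀ q, |-w q| ≤ K := fun q => by rw [abs_neg]; exact hw q
  refine ⟨⟨K, fun x => by rw [abs_neg]; exact abs_upperLimit_le hw' x⟩, fun x a ha => ?_,
    fun φ hφ x hmin => ?_⟩
  · filter_upwards [upperSemicontinuous_upperLimit hw' x (-a) (by linarith)] with y hy
    linarith
  refine hjbUpper_nonneg (w := w) fun ε hε => ?_
  set P := deriv φ x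
  set X := deriv (deriv φ) x
  obtain ⟨t, ht, htε, hKt⟩ := exists_pos_mul_le (C ^ 2 / 2 + C + C * |X| + |P|) hε
  obtain ⟨hψ, hψ1, hψ2⟩ := deriv_add_const_mul_pow_four hφ (-1) x
  have hev := eventually_quotientsNear hψ x ht
  rw [hψ1, hψ2] at hev
  have hmax : IsLocalMax (fun y : unitInterval => upperLimit (fun q => -w q) y - -φ y) x :=
    hmin.mono fun y hy => by linarith
  refine ((frequently_isMax_of_isLocalMax hw' (φ := fun y => -φ y)
    (hφ.continuous.comp continuous_subtype_val).neg hmax ht).and_eventually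
      (hev.and ((tendsto_fst_gridFilter x).eventually (hS t ht)))).mono ?_
  rintro ⟨M, i⟩ ⟨⟨h1, h2⟩, ⟨hM, hq⟩, hSM⟩
  refine ⟨?_, (EReal.coe_le_coe_iff.2 (neg_le_neg hKt)).trans
    (le_hjbOp_of_isMin hM hα hg hσ hμ (hsol M hM) hSM hq ?_)⟩
  · rw [← neg_add', abs_neg] at h1
    simpa only [sub_neg_eq_add] using h1.trans_le htε
  · intro j hj hj'
    have := h2 j hj hj'
    simp only at this ⊢
    linarith

/-! ### Convergence -/

/-- Compactness of `Λ` upgrades equicontinuity to uniform equicontinuity, so a single nearby control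
works for all `x` at once. -/
theorem eventually_exists_control_near [MetricSpace Λ] [CompactSpace Λ] {Λs : ℝ → Finset Λ}
    (hΛlim : Tendsto (fun Δ : ℝ => Metric.hausdorffEDist (Λs Δ : Set Λ) Set.univ)
      (𝓝[>] 0) (𝓝 0)) (hσ : Equicontinuous c.σ) (hμ : Equicontinuous c.μ) {ε : ℝ} (hε : 0 < ε) :
    ∀ᶠ M : ℕ in atTop, ∀ l, ∃ l' ∈ Λs (1 / M), ∀ x,
      |c.σ x l - c.σ x l'| < ε ∧ |c.μ x l - c.μ x l'| < ε := by
  obtain ⟨δ₁, hδ₁, h₁⟩ := Metric.uniformEquicontinuous_iff.1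
    (CompactSpace.uniformEquicontinuous_of_equicontinuous hσ) ε hε
  obtain ⟨δ₂, hδ₂, h₂⟩ := Metric.uniformEquicontinuous_iff.1
    (CompactSpace.uniformEquicontinuous_of_equicontinuous hμ) ε hε
  have ht : Tendsto (fun M : ℕ => 1 / (M : ℝ)) atTop (𝓝[>] 0) :=
    tendsto_nhdsWithin_iff.2 ⟨tendsto_one_div_atTop_nhds_zero_nat,
      (eventually_gt_atTop 0).mono fun M hM => by simpa using hM⟩
  have hδ : (0 : ENNReal) < ENNReal.ofReal (min δ₁ δ₂) := by simp [hδ₁, hδ₂]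
  filter_upwards [(hΛlim.comp ht).eventually (gt_mem_nhds hδ)] with M hM l
  rw [Function.comp, Metric.hausdorffEDist_comm] at hM
  obtain ⟨l', hl', hd⟩ := Metric.exists_edist_lt_of_hausdorffEDist_lt (Set.mem_univ l) hM
  rw [edist_lt_ofReal, lt_min_iff] at hd
  exact ⟨l', hl', fun x => ⟨h₁ _ _ hd.1 x, h₂ _ _ hd.2 x⟩⟩

theorem schemeDiag_pos (hη : ∀ x, 0 < c.η x) (i : Fin (M + 1)) : 0 < schemeDiag c M i := by
  unfold schemeDiag
  split_ifs
  exacts [hη _, one_pos]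

theorem schemeVec_pos (hα : ∀ x, 0 < c.α x) (hβ : ∀ x, 0 < c.β x) (hg : ∀ x, 0 < c.g x)
    (i : Fin (M + 1)) : 0 < schemeVec c M i := by
  have := hα (gridPoint M i)
  have := hβ (gridPoint M i)
  have := hg (gridPoint M i)
  unfold schemeVec
  split_ifs <;> positivity

theorem existsUnique_isPositiveSolution (hη : ∀ x, 0 < c.η x) (hα : ∀ x, 0 < c.α x)
    (hβ : ∀ x, 0 < c.β x) (hg : ∀ x, 0 < c.g x) (hS : S.Nonempty) (hM : 0 < M) :
    ∃! u : Fin (M + 1) → ℝ, IsPositiveSolution c S M u := by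
  simp only [isPositiveSolution_iff c S hM]
  exact existsUnique_quadOp_isLeast hS (schemeWeight_nonneg c M) (schemeDiag_pos hη)
    (schemeVec_pos hα hβ hg)

theorem le_iSup_of_isPositiveSolution (hη : ∀ x, 0 < c.η x) (hg : ∀ x, 0 < c.g x)
    (hbdd : BddAbove (Set.range fun x =>
      max (Real.sqrt (1 / 2 * (c.β x ^ 2 / (c.α x * c.η x)))) (c.g x))) (hM : 0 < M)
    (hu : IsPositiveSolution c S M u) (i : Fin (M + 1)) :
    u i ≤ ⨆ x, max (Real.sqrt (1 / 2 * (c.β x ^ 2 / (c.α x * c.η x)))) (c.g x) := by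
  rw [isPositiveSolution_iff c S hM] at hu
  obtain ⟨k, hk, hle⟩ := exists_max_of_quadOp_isLeast (schemeWeight_nonneg c M) hu.1 hu.2
  refine (hk i).trans (le_trans ?_ (le_ciSup hbdd (gridPoint M k)))
  have hηk := hη (gridPoint M k)
  by_cases hi : 0 < (k : ℕ) ∧ (k : ℕ) < M
  · simp only [schemeDiag, schemeVec, hi, and_self, if_true] at hle
    refine le_max_of_le_left (Real.le_sqrt_of_sq_le ?_)
    rw [← div_div, mul_div_assoc', le_div_iff₀ hηk]
    linarith
  · simp only [schemeDiag, schemeVec, hi, if_false, one_mul] at hle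
    exact le_max_of_le_right ((pow_le_pow_iff_left₀ (hu.1 k).le (hg _).le two_ne_zero).1 hle)

/-- The neighbourhoods are not punctured, so `x` itself contributes to the limit superior. -/
theorem IsBdd.le_limsup {V : unitInterval → ℝ} (hV : IsBdd V) (x : unitInterval) :
    V x ≤ limsup V (𝓝 x) := by
  obtain ⟨C, hC⟩ := hV
  refine le_limsup_of_frequently_le ?_ (isBoundedUnder_le_of_abs_le hC _)
  exact fun h => mem_of_mem_nhds h le_rfl

theorem IsBdd.liminf_le {V : unitInterval → ℝ} (hV : IsBdd V) (x : unitInterval) :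
    liminf V (𝓝 x) ≤ V x := by
  obtain ⟨C, hC⟩ := hV
  refine liminf_le_of_frequently_le ?_ (isBoundedUnder_ge_of_abs_le hC _)
  exact fun h => mem_of_mem_nhds h le_rfl

/-- A continuous function that is a sub- and a supersolution is the only viscosity solution. -/
theorem isViscositySolution_unique (hcomp : StrongComparison c) {U : unitInterval → ℝ}
    (hsub : IsSubsolution c U) (hsup : IsSupersolution c U) {V : unitInterval → ℝ}
    (hV : IsViscositySolution c V) : V = U := by
  funext x
  exact le_antisymm ((hV.1.le_limsup x).trans (hcomp _ _ hV.2.1 hsup x))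
    ((hcomp _ _ hsub hV.2.2 x).trans (hV.1.liminf_le x))

theorem isViscositySolution_of_continuous {U : unitInterval → ℝ} (hU : Continuous U)
    (hsub : IsSubsolution c U) (hsup : IsSupersolution c U) : IsViscositySolution c U := by
  have h1 : (fun x => limsup U (𝓝 x)) = U := funext fun x => (hU.tendsto x).limsup_eq
  have h2 : (fun x => liminf U (𝓝 x)) = U := funext fun x => (hU.tendsto x).liminf_eq
  exact ⟨hsub.1, h1.symm ▸ hsub, h2.symm ▸ hsup⟩

/-- If the two relaxed limits agree, then the interpolants converge uniformly. -/
theorem tendstoUniformly_interpolant {w : Grid → ℝ} {K : ℝ} (hw : ∀ q, |w q| ≤ K)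
    {U : unitInterval → ℝ} (hU : Continuous U) (h1 : upperLimit w = U)
    (h2 : (fun x => -upperLimit (fun q => -w q) x) = U) {u : (M : ℕ) → Fin (M + 1) → ℝ}
    (hu : ∀ M, 0 < M → ∀ i, u M i = w ⟨M, i⟩) :
    TendstoUniformly (fun M => interpolant M (u M)) U atTop := by
  have hw' : ∀ q, |-w q| ≤ K := fun q => by rw [abs_neg]; exact hw q
  have hlim : ∀ x, Tendsto w (gridFilter x) (𝓝 (U x)) := fun x => by
    rw [tendsto_order]
    refine ⟨fun a ha => ?_, fun a ha => eventually_lt_of_upperLimit_lt hw (by rwa [h1])⟩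
    have h3 : -upperLimit (fun q => -w q) x = U x := congrFun h2 x
    exact (eventually_lt_of_upperLimit_lt hw' (x := x) (a := -a) (by linarith)).mono
      fun q hq => neg_lt_neg_iff.1 hq
  -- On a compact space, joint convergence in mesh size and point, together with continuity of `U`,
  -- is uniform convergence.
  rw [← tendstoLocallyUniformly_iff_tendstoUniformly_of_compactSpace,
    tendstoLocallyUniformly_iff_forall_tendsto]
  intro x
  have h4 : Tendsto (fun p : ℕ × unitInterval => interpolant p.1 (u p.1) p.2)
      (atTop ×ˢ 𝓝 x) (𝓝 (U x)) := by
    refine ((hlim x).comp (tendsto_cellIndex x)).congr' ?_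
    filter_upwards [tendsto_fst.eventually (eventually_gt_atTop 0)] with p hp
    rw [interpolant_eq hp, hu _ hp, Function.comp]
  exact (((hU.tendsto x).comp tendsto_snd).prodMk_nhds h4).mono_right
    (nhds_prod_eq (x := U x) (y := U x) ▸ nhds_le_uniformity (U x))

end HJBScheme

end

/-! ### Assembly: from the discrete solutions to the viscosity solution -/

theorem mainTheorem7 {Λ : Type*} [MetricSpace Λ] [CompactSpace Λ] [Nonempty Λ]
    (c : HJBScheme.Coeffs Λ) (Λs : ℝ → Finset Λ)
    (hΛs : ∀ Δ : ℝ, 0 < Δ → (Λs Δ).Nonempty)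
    (hΛlim : Tendsto (fun Δ : ℝ => Metric.hausdorffEDist (Λs Δ : Set Λ) Set.univ)
      (𝓝[>] 0) (𝓝 0))
    (hη : ∀ x, 0 < c.η x) (hα : ∀ x, 0 < c.α x) (hβ : ∀ x, 0 < c.β x) (hg : ∀ x, 0 < c.g x)
    (hσbdd : ∃ C : ℝ, ∀ x l, |c.σ x l| ≤ C) (hμbdd : ∃ C : ℝ, ∀ x l, |c.μ x l| ≤ C)
    (hσcont : Equicontinuous c.σ) (hμcont : Equicontinuous c.μ)
    (hgbdd : BddAbove (Set.range c.g))
    (hbound : BddAbove (Set.range fun x => c.β x ^ 2 / (c.α x * c.η x)))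
    (hcomp : HJBScheme.StrongComparison c) :
    (∀ M : ℕ, 0 < M → ∃! u : Fin (M + 1) → ℝ,
      HJBScheme.IsPositiveSolution c (Λs (1 / M)) M u) ∧
    BddAbove (Set.range fun x =>
      max (Real.sqrt (1 / 2 * (c.β x ^ 2 / (c.α x * c.η x)))) (c.g x)) ∧
    (∀ M : ℕ, 0 < M → ∀ u : Fin (M + 1) → ℝ,
      HJBScheme.IsPositiveSolution c (Λs (1 / M)) M u →
      ∀ y, HJBScheme.interpolant M u y ≤
        ⨆ x, max (Real.sqrt (1 / 2 * (c.β x ^ 2 / (c.α x * c.η x)))) (c.g x)) ∧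
    ∃ U : unitInterval → ℝ,
      HJBScheme.IsViscositySolution c U ∧ Continuous U ∧
      (∀ V : unitInterval → ℝ, HJBScheme.IsViscositySolution c V → V = U) ∧
      ∀ u : (M : ℕ) → Fin (M + 1) → ℝ,
        (∀ M : ℕ, 0 < M → HJBScheme.IsPositiveSolution c (Λs (1 / M)) M (u M)) →
        TendstoUniformly (fun (M : ℕ) => HJBScheme.interpolant M (u M)) U atTop := by
  obtain ⟨Cσ, hCσ⟩ := hσbdd
  obtain ⟨Cμ, hCμ⟩ := hμbdd
  have hσ : ∀ x l, |c.σ x l| ≤ max Cσ Cμ := fun x l => (hCσ x l).trans (le_max_left _ _)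
  have hμ : ∀ x l, |c.μ x l| ≤ max Cσ Cμ := fun x l => (hCμ x l).trans (le_max_right _ _)
  have hex : ∀ M : ℕ, 0 < M → ∃! u : Fin (M + 1) → ℝ,
      HJBScheme.IsPositiveSolution c (Λs (1 / M)) M u := fun M hM =>
    HJBScheme.existsUnique_isPositiveSolution hη hα hβ hg (hΛs _ (by positivity)) hM
  have hbdd : BddAbove (Set.range fun x =>
      max (Real.sqrt (1 / 2 * (c.β x ^ 2 / (c.α x * c.η x)))) (c.g x)) := by
    obtain ⟨B, hB⟩ := hbound
    obtain ⟨G, hG⟩ := hgbdd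
    refine ⟨max (Real.sqrt (1 / 2 * B)) G, ?_⟩
    rintro _ ⟨x, rfl⟩
    exact max_le_max (Real.sqrt_le_sqrt (mul_le_mul_of_nonneg_left (hB ⟨x, rfl⟩) (by norm_num)))
      (hG ⟨x, rfl⟩)
  have hle : ∀ M : ℕ, 0 < M → ∀ u : Fin (M + 1) → ℝ,
      HJBScheme.IsPositiveSolution c (Λs (1 / M)) M u → ∀ i, u i ≤
        ⨆ x, max (Real.sqrt (1 / 2 * (c.β x ^ 2 / (c.α x * c.η x)))) (c.g x) :=
    fun M hM u hu => HJBScheme.le_iSup_of_isPositiveSolution hη hg hbdd hM hu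
  refine ⟨hex, hbdd, fun M hM u hu y => ?_, ?_⟩
  · rw [HJBScheme.interpolant_eq hM]
    exact hle M hM u hu _
  set K := ⨆ x, max (Real.sqrt (1 / 2 * (c.β x ^ 2 / (c.α x * c.η x)))) (c.g x)
  choose s hs using fun M hM => (hex M hM).exists
  -- The value `0` at `M = 0` is harmless: it respects the bound by `K`, and the limits see only
  -- large `M`.
  set w : HJBScheme.Grid → ℝ := fun q => if h : 0 < q.1 then s q.1 h q.2 else 0 with hwdef
  have hws : ∀ (M : ℕ) (hM : 0 < M), (fun i => w ⟨M, i⟩) = s M hM := fun M hM => by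
    simp [hwdef, hM]
  have hsol : ∀ M : ℕ, 0 < M →
      HJBScheme.IsPositiveSolution c (Λs (1 / M)) M fun i => w ⟨M, i⟩ := fun M hM => by
    rw [hws M hM]
    exact hs M hM
  have hK : 0 ≤ K := le_trans (le_max_of_le_left (Real.sqrt_nonneg _)) (le_ciSup hbdd 0)
  have hw : ∀ q, |w q| ≤ K := by
    rintro ⟨M, i⟩
    rcases Nat.eq_zero_or_pos M with rfl | hM
    · simpa [hwdef] using hK
    · rw [abs_of_pos ((hsol M hM).1 i)]
      exact hle M hM _ (hsol M hM) i
  have hsub := HJBScheme.isSubsolution_upperLimit hα hβ hg hσ hμ hw hsol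
  have hsup := HJBScheme.isSupersolution_neg_upperLimit_neg hα hg hσ hμ
    (S := fun M => Λs (1 / M))
    (fun ε hε => HJBScheme.eventually_exists_control_near hΛlim hσcont hμcont hε) hw hsol
  -- One inequality is automatic; the other is strong comparison applied to the two relaxed limits.
  have heq : (fun x => -HJBScheme.upperLimit (fun q => -w q) x) = HJBScheme.upperLimit w :=
    funext fun x => le_antisymm (HJBScheme.neg_upperLimit_neg_le hw x) (hcomp _ _ hsub hsup x)
  have hcont : Continuous (HJBScheme.upperLimit w) :=
    continuous_iff_lower_upperSemicontinuous.2 ⟨heq ▸ hsup.2.1, hsub.2.1⟩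
  have hsup' := heq ▸ hsup
  refine ⟨HJBScheme.upperLimit w,
    HJBScheme.isViscositySolution_of_continuous hcont hsub hsup', hcont,
    fun V hV => HJBScheme.isViscositySolution_unique hcomp hsub hsup' hV, fun u hu => ?_⟩
  refine HJBScheme.tendstoUniformly_interpolant hw hcont rfl heq fun M hM i => ?_
  exact congrFun ((hex M hM).unique (hu M hM) (hsol M hM)) i
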